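/- Let $G$ and $H$ be locally compact second countable (Hausdorff) groups. A metric on such a group is called \emph{admissible} if it induces the group topology, is left-invariant, and is proper, i.e. its closed balls are compact. A map $\phi\colon X\to Y$ between metric spaces is a \emph{coarse equivalence} if $\sup_{y\in Y}d(y,\phi[X])<\infty$ and, for all sequences $(x_n),(z_n)$ in $X$, $$\lim_n d(x_n,z_n)=\infty\iff \lim_n d(\phi(x_n),\phi(z_n))=\infty .$$ The groups $G$ and $H$ are \emph{coarsely equivalent} if there are admissible metrics $d_G$ on $G$ and $d_H$ on $H$ and a coarse equivalence $\phi\colon (G,d_G)\to (H,d_H)$. A \emph{topological coupling} of $G$ and $H$ is a pair $G\curvearrowright X\curvearrowleft H$ of commuting continuous actions (a left action of $G$ and a right action of $H$) on a non-empty locally compact Hausdorff space $X$ that are proper, i.e. for every compact $K\subseteq X$ the sets $\{g\in G\mid gK\cap K\neq\emptyset\}$ and $\{h\in H\mid Kh\cap K\neq\emptyset\}$ are compact, and cocompact, i.e. $X=G\cdot K=K\cdot H$ for some compact $K\subseteq X$. Then $G$ and $H$ are coarsely equivalent if and only if they admit a topological coupling. Moreover, for all admissible metrics $d_G$ on $G$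 and $d_H$ on $H$, there is a coarse equivalence $(G,d_G)\to(H,d_H)$ if and only if $G$ and $H$ admit a topological coupling. -/

import Mathlib

open Filter MulOpposite
open scoped Pointwise

/-- A coarse equivalence between two metric spaces: a map with cobounded image such that,
for all sequences of pairs, distances tend to infinity in the source if and only if they
tend to infinity in the target. -/
structure IsCoarseEquivalence {X Y : Type*} (mX : MetricSpace X) (mY : MetricSpace Y)
    (φ : X → Y) : Prop where
  cobounded : ∃ R : ℝ, ∀ y : Y, ∃ x : X, dist y (φ x) ≤ R
  tendsto_iff : ∀ x z : ℕ → X,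
    Tendsto (fun n => dist (x n) (z n)) atTop atTop ↔
      Tendsto (fun n => dist (φ (x n)) (φ (z n))) atTop atTop

/-- The metric `m` on the topological group `G` is compatible with the topology of `G`,
left-invariant, and proper (closed balls are compact). -/
structure IsCompatibleProperLeftInvariant {G : Type*} [Group G] [t : TopologicalSpace G]
    (m : MetricSpace G) : Prop where
  compatible : m.toUniformSpace.toTopologicalSpace = t
  left_invariant : ∀ g x y : G, m.dist (g * x) (g * y) = m.dist x y
  proper : ∀ (x : G) (r : ℝ), @IsCompact G t {y : G | m.dist y x ≤ r}

/-- Two topological groups are coarsely equivalent if there is a coarse equivalence between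
them for some compatible proper left-invariant metrics. -/
def CoarselyEquivalent (G H : Type*) [Group G] [TopologicalSpace G] [Group H]
    [TopologicalSpace H] : Prop :=
  ∃ (dG : MetricSpace G) (dH : MetricSpace H),
    IsCompatibleProperLeftInvariant dG ∧ IsCompatibleProperLeftInvariant dH ∧
      ∃ φ : G → H, IsCoarseEquivalence dG dH φ

/-- A left action of `G` and a right action of `H` (written, as usual, as an action of the
opposite group, `x · h = op h • x`) form a topological coupling on `X`. The space is required
to be non-empty, since otherwise all conditions hold trivially. -/
structure IsTopologicalCoupling (G H X : Type*) [Group G] [TopologicalSpace G] [Group H]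
    [TopologicalSpace H] [TopologicalSpace X] [MulAction G X] [MulAction Hᵐᵒᵖ X] : Prop where
  nonempty : Nonempty X
  t2Space : T2Space X
  locallyCompactSpace : LocallyCompactSpace X
  commute : ∀ (g : G) (h : H) (x : X), g • (op h • x) = op h • (g • x)
  continuous_left : Continuous fun p : G × X => p.1 • p.2
  continuous_right : Continuous fun p : X × H => op p.2 • p.1
  proper_left : ∀ K : Set X, IsCompact K → IsCompact {g : G | ((g • K) ∩ K).Nonempty}
  proper_right : ∀ K : Set X, IsCompact K → IsCompact {h : H | ((op h • K) ∩ K).Nonempty}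
  cocompact : ∃ K : Set X, IsCompact K ∧ (⋃ g : G, g • K) = Set.univ ∧
    (⋃ h : H, op h • K) = Set.univ

universe u v w

/-- `G` and `H` admit a topological coupling. The universe `w` is arbitrary, so the space may
live in any universe that is at least as large as those of `G` and `H`. -/
def AdmitTopologicalCoupling (G : Type u) (H : Type v) [Group G] [TopologicalSpace G]
    [Group H] [TopologicalSpace H] : Prop :=
  ∃ (X : Type (max u v w)) (_ : TopologicalSpace X) (_ : MulAction G X)
    (_ : MulAction Hᵐᵒᵖ X), IsTopologicalCoupling G H X

open Topology
open scoped NNReal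

/-!
Given a coupling `X` with a base point `x₀` and a compact set `K` whose translates under either
group cover `X`, relate `g` and `h` when `g⁻¹ x₀ h ∈ K`. Properness of the two actions bounds the
distance of two elements of one group in terms of the distance of related elements of the other, so
any choice function for this relation is a coarse equivalence.

Conversely, the distance on `G × H` to the graph of a coarse equivalence is a `1`-Lipschitz function
of each variable, which is small only near a single point when the other variable is fixed. For
fixed control data the functions with this property form a locally compact space for the topology
of pointwise convergence, and translating the two variables defines a coupling: a function and its
translate can both be small at the identity only if the translation is bounded, and every function
can be translated so as to be small there.

Compatible proper left-invariant metrics exist by Struble's theorem: compact symmetric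
neighbourhoods `U n`, `n ∈ ℤ`, with `U n * U n * U n ⊆ U (n + 1)` behave like balls of radius
`2 ^ n`, and chaining turns the resulting length function into a metric.
-/

theorem exists_int_seq_rel_add_one {α : Type*} [Nonempty α] {r : ℤ → α → α → Prop}
    (up : ∀ n, 0 ≤ n → ∀ a, ∃ b, r n a b) (down : ∀ n, n < 0 → ∀ b, ∃ a, r n a b) :
    ∃ u : ℤ → α, ∀ n, r n (u n) (u (n + 1)) := by
  choose! next h_next using up
  choose! prev h_prev using down
  obtain ⟨a₀⟩ := ‹Nonempty α›
  let P : ℕ → α := fun n => Nat.rec a₀ (fun k a => next k a) n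
  let N : ℕ → α := fun n => Nat.rec a₀ (fun k a => prev (Int.negSucc k) a) n
  refine ⟨fun
    | Int.ofNat n => P n
    | Int.negSucc n => N (n + 1), fun
    | Int.ofNat n => h_next n (Int.natCast_nonneg n) (P n)
    | Int.negSucc 0 => h_prev (Int.negSucc 0) (by decide) (N 0)
    | Int.negSucc (n + 1) => h_prev (Int.negSucc (n + 1)) (Int.negSucc_lt_zero _) (N (n + 1))⟩

section CompactFiltration

variable {G : Type*} [Group G] [TopologicalSpace G]

/-- A compact symmetric neighbourhood of the identity. -/
structure IsCompactSymmNhd (S : Set G) : Prop where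
  isCompact : IsCompact S
  inv_eq : S⁻¹ = S
  mem_nhds : S ∈ 𝓝 (1 : G)

/-- A two-sided filtration of a topological group by compact symmetric neighbourhoods of the
identity, shrinking to the identity at `-∞`, exhausting the group at `+∞`, and growing fast enough
that triple products move up by at most one step. It plays the role of the family of balls of
radius `2 ^ n` around the identity. -/
structure IsCompactFiltration (U : ℤ → Set G) : Prop where
  isCompactSymmNhd : ∀ n, IsCompactSymmNhd (U n)
  mul_mul_subset : ∀ n, U n * U n * U n ⊆ U (n + 1)
  exists_mem : ∀ g, ∃ n, g ∈ U n
  hasBasis_nhds_one : (𝓝 (1 : G)).HasBasis (fun _ => True) U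

theorem subset_mul_mul_self {M : Type*} [MulOneClass M] {S : Set M} (h : 1 ∈ S) :
    S ⊆ S * S * S :=
  (Set.subset_mul_left S h).trans (Set.subset_mul_left (S * S) h)

namespace IsCompactSymmNhd

theorem one_mem {S : Set G} (hS : IsCompactSymmNhd S) : 1 ∈ S :=
  mem_of_mem_nhds hS.mem_nhds

variable [IsTopologicalGroup G] {S : Set G}

theorem union_inv (hS : IsCompact S) (h : S ∈ 𝓝 1) : IsCompactSymmNhd (S ∪ S⁻¹) where
  isCompact := hS.union hS.inv
  inv_eq := by rw [Set.union_inv, inv_inv, Set.union_comm]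
  mem_nhds := mem_of_superset h Set.subset_union_left

theorem exists_superset (hS : IsCompactSymmNhd S) {K : Set G} (hK : IsCompact K) :
    ∃ T, IsCompactSymmNhd T ∧ S * S * S ⊆ T ∧ K ⊆ T := by
  have hSK : IsCompact (S * S * S ∪ K) :=
    ((hS.isCompact.mul hS.isCompact).mul hS.isCompact).union hK
  have h_nhds : S * S * S ∪ K ∈ 𝓝 1 := mem_of_superset hS.mem_nhds
    ((subset_mul_mul_self hS.one_mem).trans Set.subset_union_left)
  exact ⟨_, union_inv hSK h_nhds, Set.subset_union_left.trans Set.subset_union_left,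
    Set.subset_union_right.trans Set.subset_union_left⟩

theorem exists_subset (hS : IsCompactSymmNhd S) {V : Set G} (hV : V ∈ 𝓝 1) :
    ∃ T, IsCompactSymmNhd T ∧ T * T * T ⊆ S ∧ T ⊆ V := by
  obtain ⟨W, hW, -, -, hWW⟩ :=
    exists_closed_nhds_one_inv_eq_mul_subset (inter_mem hS.mem_nhds hV)
  obtain ⟨T, hT, hT_closed, hT_inv, hTT⟩ := exists_closed_nhds_one_inv_eq_mul_subset hW
  have hT1 : 1 ∈ T := mem_of_mem_nhds hT
  have hTTT : T * T * T ⊆ S ∩ V :=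
    (Set.mul_subset_mul hTT ((Set.subset_mul_left T hT1).trans hTT)).trans hWW
  have hTSV : T ⊆ S ∩ V := (subset_mul_mul_self hT1).trans hTTT
  exact ⟨T, ⟨hS.isCompact.of_isClosed_subset hT_closed (hTSV.trans Set.inter_subset_left),
    hT_inv, hT⟩, hTTT.trans Set.inter_subset_left, hTSV.trans Set.inter_subset_right⟩

end IsCompactSymmNhd

theorem exists_isCompactFiltration (G : Type*) [Group G] [TopologicalSpace G]
    [IsTopologicalGroup G] [WeaklyLocallyCompactSpace G] [SigmaCompactSpace G]
    [FirstCountableTopology G] : ∃ U : ℤ → Set G, IsCompactFiltration U := by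
  obtain ⟨C, hC, hC1⟩ := exists_compact_mem_nhds (1 : G)
  obtain ⟨B, hB⟩ := (𝓝 (1 : G)).exists_antitone_basis
  have : Nonempty {S : Set G // IsCompactSymmNhd S} := ⟨_, IsCompactSymmNhd.union_inv hC hC1⟩
  obtain ⟨U, hU⟩ := exists_int_seq_rel_add_one (α := {S : Set G // IsCompactSymmNhd S})
    (r := fun n S T => S.1 * S.1 * S.1 ⊆ T.1 ∧ (0 ≤ n → compactCovering G n.toNat ⊆ T.1) ∧
      (n < 0 → S.1 ⊆ B (-n).toNat))
    (fun n hn S => by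
      obtain ⟨T, hT, hST, hKT⟩ := S.2.exists_superset (isCompact_compactCovering G n.toNat)
      exact ⟨⟨T, hT⟩, hST, fun _ => hKT, fun h => absurd h hn.not_gt⟩)
    (fun n hn T => by
      obtain ⟨S, hS, hST, hSB⟩ := T.2.exists_subset (hB.mem (-n).toNat)
      exact ⟨⟨S, hS⟩, hST, fun h => absurd h hn.not_ge, fun _ => hSB⟩)
  refine ⟨fun n => (U n).1, fun n => (U n).2, fun n => (hU n).1, fun g => ?_,
    hB.1.to_hasBasis (fun k _ => ⟨-(k + 1), trivial, ?_⟩)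
      fun n _ => hB.1.mem_iff.1 (U n).2.mem_nhds⟩
  · obtain ⟨k, hk⟩ := exists_mem_compactCovering g
    exact ⟨k + 1, (hU k).2.1 (Int.natCast_nonneg k) hk⟩
  · have hUB := (hU (-(k + 1))).2.2 (by lia)
    rw [neg_neg] at hUB
    exact hUB.trans (hB.2 (Nat.le_succ k))

end CompactFiltration

section FiltrationLength

/-- The length of `g` with respect to a filtration `U`: the infimum of the numbers `2 ^ n` over
all `n` with `g ∈ U n`. It is the input of the chaining construction of a left-invariant metric;
the junk value at an element lying in no `U n` is `0`. -/
noncomputable def filtrationLength {α : Type*} (U : ℤ → Set α) (g : α) : ℝ≥0 :=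
  ⨅ n : {n : ℤ // g ∈ U n}, (2 : ℝ≥0) ^ (n : ℤ)

theorem filtrationLength_le {α : Type*} {U : ℤ → Set α} {g : α} {n : ℤ} (h : g ∈ U n) :
    filtrationLength U g ≤ 2 ^ n :=
  ciInf_le (OrderBot.bddBelow _) (⟨n, h⟩ : {n : ℤ // g ∈ U n})

namespace IsCompactFiltration

variable {G : Type*} [Group G] [TopologicalSpace G] {U : ℤ → Set G}

theorem one_mem (hU : IsCompactFiltration U) (n : ℤ) : 1 ∈ U n :=
  (hU.isCompactSymmNhd n).one_mem

theorem monotone (hU : IsCompactFiltration U) : Monotone U :=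
  monotone_int_of_le_succ fun n =>
    (subset_mul_mul_self (hU.one_mem n)).trans (hU.mul_mul_subset n)

theorem mem_of_filtrationLength_lt (hU : IsCompactFiltration U) {g : G} {n : ℤ}
    (h : filtrationLength U g < 2 ^ (n + 1)) : g ∈ U n := by
  have : Nonempty {n : ℤ // g ∈ U n} := nonempty_subtype.2 (hU.exists_mem g)
  obtain ⟨⟨m, hm⟩, hmn⟩ := exists_lt_of_ciInf_lt h
  have : m < n + 1 := (zpow_lt_zpow_iff_right₀ (one_lt_two : (1 : ℝ≥0) < 2)).1 hmn
  exact hU.monotone (Int.lt_add_one_iff.1 this) hm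

theorem filtrationLength_one (hU : IsCompactFiltration U) : filtrationLength U 1 = 0 := by
  refine le_antisymm (le_of_forall_pos_le_add fun ε hε => ?_) zero_le
  obtain ⟨n, hn, -⟩ := exists_mem_Ico_zpow (y := (2 : ℝ≥0)) hε one_lt_two
  simpa using (filtrationLength_le (hU.one_mem n)).trans hn

theorem filtrationLength_inv (hU : IsCompactFiltration U) (g : G) :
    filtrationLength U g⁻¹ = filtrationLength U g := by
  have h_mem : ∀ n, g⁻¹ ∈ U n ↔ g ∈ U n := fun n => by
    rw [← Set.mem_inv, (hU.isCompactSymmNhd n).inv_eq]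
  exact (Equiv.subtypeEquivRight h_mem).iInf_congr fun _ => rfl

theorem filtrationLength_mul_mul_le (hU : IsCompactFiltration U) (a b c : G) :
    filtrationLength U (a * b * c) ≤
      2 * max (filtrationLength U a) (max (filtrationLength U b) (filtrationLength U c)) := by
  rw [← div_le_iff₀' two_pos]
  refine le_of_forall_gt_imp_ge_of_dense fun t ht => ?_
  obtain ⟨n, hnt, htn⟩ := exists_mem_Ico_zpow (y := (2 : ℝ≥0)) (zero_le.trans_lt ht) one_lt_two
  obtain ⟨ha, hb, hc⟩ : a ∈ U n ∧ b ∈ U n ∧ c ∈ U n := by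
    simp only [max_lt_iff] at ht
    exact ⟨hU.mem_of_filtrationLength_lt (ht.1.trans htn),
      hU.mem_of_filtrationLength_lt (ht.2.1.trans htn),
      hU.mem_of_filtrationLength_lt (ht.2.2.trans htn)⟩
  have habc : a * b * c ∈ U (n + 1) :=
    hU.mul_mul_subset n (Set.mul_mem_mul (Set.mul_mem_mul ha hb) hc)
  rw [div_le_iff₀ two_pos]
  calc filtrationLength U (a * b * c) ≤ 2 ^ (n + 1) := filtrationLength_le habc
    _ = 2 ^ n * 2 := zpow_add_one₀ two_ne_zero n
    _ ≤ t * 2 := by gcongr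

end IsCompactFiltration

end FiltrationLength

section Struble

theorem dist_ofPreNNDist_map_le {X Y : Type*} {d : X → X → ℝ≥0} {d' : Y → Y → ℝ≥0}
    (d_self : ∀ x, d x x = 0) (d_comm : ∀ x y, d x y = d y x)
    (d'_self : ∀ x, d' x x = 0) (d'_comm : ∀ x y, d' x y = d' y x)
    {f : X → Y} (hf : ∀ x y, d' (f x) (f y) ≤ d x y) (x y : X) :
    (PseudoMetricSpace.ofPreNNDist d' d'_self d'_comm).dist (f x) (f y) ≤
      (PseudoMetricSpace.ofPreNNDist d d_self d_comm).dist x y := by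
  refine NNReal.coe_le_coe.2 (le_ciInf fun l => ?_)
  refine (ciInf_le (OrderBot.bddBelow _) (l.map f)).trans ?_
  have h_cons : f x :: l.map f = (x :: l).map f := rfl
  have h_append : l.map f ++ [f y] = (l ++ [y]).map f := by simp
  rw [h_cons, h_append, List.zipWith_map, ← List.map_uncurry_zip_eq_zipWith,
    ← List.map_uncurry_zip_eq_zipWith]
  exact List.sum_le_sum fun p _ => hf p.1 p.2

namespace IsCompactFiltration

variable {G : Type*} [Group G] [TopologicalSpace G] {U : ℤ → Set G}

/-- The left-invariant pseudometric obtained by chaining from the length function of a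
filtration. -/
noncomputable abbrev pseudoMetricSpace (hU : IsCompactFiltration U) : PseudoMetricSpace G :=
  PseudoMetricSpace.ofPreNNDist (fun x y => filtrationLength U (x⁻¹ * y))
    (fun x => by rw [inv_mul_cancel, hU.filtrationLength_one])
    (fun x y => by rw [← hU.filtrationLength_inv, mul_inv_rev, inv_inv])

theorem dist_mul_left (hU : IsCompactFiltration U) (g x y : G) :
    hU.pseudoMetricSpace.dist (g * x) (g * y) = hU.pseudoMetricSpace.dist x y := by
  have h_le : ∀ g x y : G,
      hU.pseudoMetricSpace.dist (g * x) (g * y) ≤ hU.pseudoMetricSpace.dist x y := fun g =>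
    dist_ofPreNNDist_map_le _ _ _ _ fun x y => by simp [mul_assoc]
  exact (h_le g x y).antisymm (by simpa using h_le g⁻¹ (g * x) (g * y))

theorem dist_le_of_mem (hU : IsCompactFiltration U) {x y : G} {n : ℤ} (h : x⁻¹ * y ∈ U n) :
    hU.pseudoMetricSpace.dist x y ≤ 2 ^ n :=
  (PseudoMetricSpace.dist_ofPreNNDist_le _ _ _ x y).trans
    (by exact_mod_cast filtrationLength_le h)

theorem mem_of_dist_lt (hU : IsCompactFiltration U) {x y : G} {n : ℤ}
    (h : hU.pseudoMetricSpace.dist x y < 2 ^ n) : x⁻¹ * y ∈ U n := by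
  refine hU.mem_of_filtrationLength_lt (NNReal.coe_lt_coe.1 ?_)
  calc (filtrationLength U (x⁻¹ * y) : ℝ)
      ≤ 2 * hU.pseudoMetricSpace.dist x y :=
        PseudoMetricSpace.le_two_mul_dist_ofPreNNDist _ _ _ (fun a b c e => by
          simpa [mul_assoc] using
            hU.filtrationLength_mul_mul_le (a⁻¹ * b) (b⁻¹ * c) (c⁻¹ * e)) x y
    _ < 2 * 2 ^ n := by gcongr
    _ = ((2 ^ (n + 1) : ℝ≥0) : ℝ) := by
        push_cast
        rw [zpow_add_one₀ two_ne_zero, mul_comm]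

theorem eq_of_dist_eq_zero [T1Space G] (hU : IsCompactFiltration U) {x y : G}
    (h : hU.pseudoMetricSpace.dist x y = 0) : x = y := by
  refine inv_mul_eq_one.1 (by_contra fun hne : x⁻¹ * y ≠ 1 => ?_)
  obtain ⟨n, -, hn⟩ := hU.hasBasis_nhds_one.mem_iff.1 (isOpen_ne.mem_nhds hne.symm)
  exact hn (hU.mem_of_dist_lt (h.trans_lt (by positivity))) rfl

theorem hasBasis_nhds [IsTopologicalGroup G] (hU : IsCompactFiltration U) (x : G) :
    (𝓝 x).HasBasis (fun _ => True) fun n => x • U n := by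
  rw [← map_mul_left_nhds_one x]
  exact hU.hasBasis_nhds_one.map (x * ·)

theorem toTopologicalSpace_eq [IsTopologicalGroup G] (hU : IsCompactFiltration U) :
    hU.pseudoMetricSpace.toUniformSpace.toTopologicalSpace = ‹TopologicalSpace G› := by
  refine TopologicalSpace.ext_nhds fun x => ?_
  refine (@Metric.nhds_basis_ball G hU.pseudoMetricSpace x).ext (hU.hasBasis_nhds x)
    (fun ε hε => ?_) fun n _ => ⟨2 ^ n, by positivity, fun y hy => ?_⟩
  · obtain ⟨n, hn, -⟩ := exists_mem_Ioc_zpow hε (one_lt_two : (1 : ℝ) < 2)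
    refine ⟨n, trivial, fun y hy => ?_⟩
    rw [Set.mem_smul_set_iff_inv_smul_mem] at hy
    exact (@Metric.mem_ball' G hU.pseudoMetricSpace _ _ _).2 ((hU.dist_le_of_mem hy).trans_lt hn)
  · exact Set.mem_smul_set_iff_inv_smul_mem.2
      (hU.mem_of_dist_lt ((@Metric.mem_ball' G hU.pseudoMetricSpace _ _ _).1 hy))

theorem closedBall_subset_smul (hU : IsCompactFiltration U) {r : ℝ} {n : ℤ} (h : r < 2 ^ n)
    (x : G) : @Metric.closedBall G hU.pseudoMetricSpace x r ⊆ x • U n := fun _ hy =>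
  Set.mem_smul_set_iff_inv_smul_mem.2 (hU.mem_of_dist_lt
    (((@Metric.mem_closedBall' G hU.pseudoMetricSpace _ _ _).1 hy).trans_lt h))

theorem isCompact_closedBall [IsTopologicalGroup G] (hU : IsCompactFiltration U) (x : G)
    (r : ℝ) : IsCompact (@Metric.closedBall G hU.pseudoMetricSpace x r) := by
  obtain ⟨n, hn⟩ := pow_unbounded_of_one_lt r (one_lt_two : (1 : ℝ) < 2)
  refine ((hU.isCompactSymmNhd n).isCompact.smul x).of_isClosed_subset ?_
    (hU.closedBall_subset_smul (by exact_mod_cast hn) x)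
  convert @Metric.isClosed_closedBall G hU.pseudoMetricSpace x r
  exact hU.toTopologicalSpace_eq.symm

theorem exists_isCompatibleProperLeftInvariant [IsTopologicalGroup G] [T1Space G]
    (hU : IsCompactFiltration U) : ∃ m : MetricSpace G, IsCompatibleProperLeftInvariant m :=
  ⟨{ hU.pseudoMetricSpace with eq_of_dist_eq_zero := hU.eq_of_dist_eq_zero },
    hU.toTopologicalSpace_eq, hU.dist_mul_left, hU.isCompact_closedBall⟩

end IsCompactFiltration

theorem exists_isCompatibleProperLeftInvariant (G : Type*) [Group G] [TopologicalSpace G]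
    [IsTopologicalGroup G] [T1Space G] [WeaklyLocallyCompactSpace G] [SigmaCompactSpace G]
    [FirstCountableTopology G] : ∃ m : MetricSpace G, IsCompatibleProperLeftInvariant m :=
  let ⟨_, hU⟩ := exists_isCompactFiltration G
  hU.exists_isCompatibleProperLeftInvariant

end Struble

section CoarseEquivalence

theorem forall_tendsto_imp_tendsto_iff_exists_bound {α : Type*} {a b : α → ℝ} :
    (∀ x : ℕ → α, Tendsto (fun n => b (x n)) atTop atTop →
      Tendsto (fun n => a (x n)) atTop atTop) ↔ ∀ r, ∃ C, ∀ p, a p ≤ r → b p ≤ C := by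
  have h_seq := tendsto_iff_seq_tendsto (f := a) (k := comap b atTop) (l := atTop)
  simp only [tendsto_comap_iff, Function.comp_def] at h_seq
  rw [← h_seq, (atTop_basis_Ioi.comap b).tendsto_iff atTop_basis_Ioi]
  simp only [true_and, forall_true_left, Set.mem_preimage, Set.mem_Ioi]
  exact forall_congr' fun r => exists_congr fun C => forall_congr' fun p => by
    rw [← not_imp_not, not_lt, not_lt]

theorem isCoarseEquivalence_iff {X Y : Type*} [mX : MetricSpace X] [mY : MetricSpace Y]
    {φ : X → Y} : IsCoarseEquivalence mX mY φ ↔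
      (∃ R : ℝ, ∀ y, ∃ x, dist y (φ x) ≤ R) ∧
      (∀ r, ∃ C, ∀ x z, dist x z ≤ r → dist (φ x) (φ z) ≤ C) ∧
      ∀ r, ∃ C, ∀ x z, dist (φ x) (φ z) ≤ r → dist x z ≤ C := by
  have h_forth := forall_tendsto_imp_tendsto_iff_exists_bound (α := X × X)
    (a := fun p => dist p.1 p.2) (b := fun p => dist (φ p.1) (φ p.2))
  have h_back := forall_tendsto_imp_tendsto_iff_exists_bound (α := X × X)
    (a := fun p => dist (φ p.1) (φ p.2)) (b := fun p => dist p.1 p.2)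
  simp only [Prod.forall] at h_forth h_back
  rw [← h_forth, ← h_back]
  exact ⟨fun h => ⟨h.cobounded, fun x => (h.tendsto_iff _ _).2, fun x => (h.tendsto_iff _ _).1⟩,
    fun ⟨h, h₁, h₂⟩ => ⟨h, fun x z => ⟨h₂ fun n => (x n, z n), h₁ fun n => (x n, z n)⟩⟩⟩

theorem exists_isCoarseEquivalence_of_rel {X Y : Type*} [mX : MetricSpace X]
    [mY : MetricSpace Y] {r : X → Y → Prop}
    (exists_right : ∀ x, ∃ y, r x y) (exists_left : ∀ y, ∃ x, r x y)
    (bound_right : ∀ s, ∃ C, ∀ x x' y y', r x y → r x' y' → dist x x' ≤ s → dist y y' ≤ C)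
    (bound_left : ∀ s, ∃ C, ∀ x x' y y', r x y → r x' y' → dist y y' ≤ s → dist x x' ≤ C) :
    ∃ φ : X → Y, IsCoarseEquivalence mX mY φ := by
  choose φ hφ using exists_right
  refine ⟨φ, isCoarseEquivalence_iff.2 ⟨?_, fun s => ?_, fun s => ?_⟩⟩
  · obtain ⟨C, hC⟩ := bound_right 0
    refine ⟨C, fun y => ?_⟩
    obtain ⟨x, hx⟩ := exists_left y
    exact ⟨x, hC x x y (φ x) hx (hφ x) (dist_self x).le⟩
  · exact (bound_right s).imp fun C hC x z => hC x z _ _ (hφ x) (hφ z)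
  · exact (bound_left s).imp fun C hC x z => hC x z _ _ (hφ x) (hφ z)

end CoarseEquivalence

section CouplingToCoarseEquivalence

theorem exists_isCompact_forall_apply_eq_apply {S T X : Type*} [TopologicalSpace S]
    [TopologicalSpace T] [TopologicalSpace X] {a : T → X → X} {b : S → X → X}
    (ha : Continuous fun q : T × X => a q.1 q.2)
    (hb : ∀ K : Set X, IsCompact K → IsCompact {s | (b s '' K ∩ K).Nonempty})
    {A : Set T} (hA : IsCompact A) {K : Set X} (hK : IsCompact K) :
    ∃ C : Set S, IsCompact C ∧ ∀ t ∈ A, ∀ s, ∀ p ∈ K, ∀ q ∈ K, a t p = b s q → s ∈ C :=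
  ⟨_, hb _ (hK.union ((hA.prod hK).image ha)), fun t ht s p hp q hq hpq =>
    ⟨b s q, Set.mem_image_of_mem _ (Or.inl hq), Or.inr ⟨(t, p), ⟨ht, hp⟩, hpq⟩⟩⟩

theorem dist_inv_mul_one {G : Type*} [Group G] [PseudoMetricSpace G] [IsIsometricSMul G G]
    (x y : G) : dist (x⁻¹ * y) 1 = dist x y := by
  rw [← dist_mul_left x, mul_inv_cancel_left, mul_one, dist_comm]

theorem exists_dist_le_of_apply_eq_apply {G H X : Type*} [Group G] [PseudoMetricSpace G]
    [ProperSpace G] [IsIsometricSMul G G] [Group H] [PseudoMetricSpace H] [IsIsometricSMul H H]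
    [TopologicalSpace X] {a : G → X → X} {b : H → X → X}
    (ha : Continuous fun q : G × X => a q.1 q.2)
    (hb : ∀ K : Set X, IsCompact K → IsCompact {s | (b s '' K ∩ K).Nonempty})
    {K : Set X} (hK : IsCompact K) (s : ℝ) :
    ∃ C, ∀ x x' y y', ∀ p ∈ K, ∀ q ∈ K, a (x⁻¹ * x') p = b (y⁻¹ * y') q → dist x x' ≤ s →
      dist y y' ≤ C := by
  obtain ⟨D, hD, hDK⟩ :=
    exists_isCompact_forall_apply_eq_apply ha hb (isCompact_closedBall (1 : G) s) hK
  obtain ⟨C, hC⟩ := hD.isBounded.subset_closedBall 1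
  refine ⟨C, fun x x' y y' p hp q hq hpq hs => ?_⟩
  rw [← dist_inv_mul_one] at hs ⊢
  exact hC (hDK _ hs _ p hp q hq hpq)

theorem IsTopologicalCoupling.exists_isCoarseEquivalence {G H X : Type*} [Group G]
    [mG : MetricSpace G] [ProperSpace G] [IsIsometricSMul G G]
    [Group H] [mH : MetricSpace H] [ProperSpace H] [IsIsometricSMul H H]
    [TopologicalSpace X] [MulAction G X] [MulAction Hᵐᵒᵖ X]
    (hX : IsTopologicalCoupling G H X) : ∃ φ : G → H, IsCoarseEquivalence mG mH φ := by
  obtain ⟨K, hK, hGK, hHK⟩ := hX.cocompact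
  obtain ⟨x₀⟩ := hX.nonempty
  have h_cocycle : ∀ (g g' : G) (h h' : H),
      (g⁻¹ * g') • op h' • g'⁻¹ • x₀ = op (h⁻¹ * h') • op h • g⁻¹ • x₀ := by
    intro g g' h h'
    rw [hX.commute, smul_smul, smul_smul (op _), ← op_mul]
    simp
  refine exists_isCoarseEquivalence_of_rel (r := fun g h => op h • g⁻¹ • x₀ ∈ K)
    (fun g => ?_) (fun h => ?_) (fun s => ?_) (fun s => ?_)
  · obtain ⟨h, hh⟩ := Set.mem_iUnion.1 (hHK.symm ▸ Set.mem_univ (g⁻¹ • x₀))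
    exact ⟨h⁻¹, Set.mem_smul_set_iff_inv_smul_mem.1 hh⟩
  · obtain ⟨g, hg⟩ := Set.mem_iUnion.1 (hGK.symm ▸ Set.mem_univ (op h • x₀))
    exact ⟨g, hX.commute g⁻¹ h x₀ ▸ Set.mem_smul_set_iff_inv_smul_mem.1 hg⟩
  · obtain ⟨C, hC⟩ := exists_dist_le_of_apply_eq_apply hX.continuous_left hX.proper_right hK s
    exact ⟨C, fun g g' h h' hgh hgh' =>
      hC g g' h h' _ hgh' _ hgh (h_cocycle g g' h h')⟩
  · obtain ⟨C, hC⟩ := exists_dist_le_of_apply_eq_apply (a := fun (h : H) (x : X) => op h • x)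
      (b := fun (g : G) (x : X) => g • x) (hX.continuous_right.comp continuous_swap)
      hX.proper_left hK s
    exact ⟨C, fun g g' h h' hgh hgh' =>
      hC h h' g g' _ hgh _ hgh' (h_cocycle g g' h h').symm⟩

end CouplingToCoarseEquivalence

section CoarseDistance

/-- A function that looks, up to the control function `ρ` and the constant `R`, like the distance
to some point. The inequality `F x < s` is strict so that the condition survives pointwise
limits. -/
structure IsCoarseDist {X : Type*} [PseudoMetricSpace X] (ρ : ℝ → ℝ) (R : ℝ) (F : X → ℝ) :
    Prop where
  nonneg : ∀ x, 0 ≤ F x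
  lipschitz : LipschitzWith 1 F
  exists_center : ∃ c, F c ≤ R ∧ ∀ s x, F x < s → dist x c ≤ ρ s

namespace IsCoarseDist

variable {X Y : Type*} [PseudoMetricSpace X] [PseudoMetricSpace Y] {ρ : ℝ → ℝ} {R : ℝ}
  {F : X → ℝ}

theorem dist_le (hF : IsCoarseDist ρ R F) {s : ℝ} {x x' : X} (h : F x < s) (h' : F x' < s) :
    dist x x' ≤ 2 * ρ s := by
  obtain ⟨c, -, hc⟩ := hF.exists_center
  linarith [dist_triangle_right x x' c, hc s x h, hc s x' h']

theorem comp_isometryEquiv (hF : IsCoarseDist ρ R F) (e : Y ≃ᵢ X) :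
    IsCoarseDist ρ R fun y => F (e y) where
  nonneg y := hF.nonneg (e y)
  lipschitz := (hF.lipschitz.comp e.isometry.lipschitz).weaken (one_mul 1).le
  exists_center := by
    obtain ⟨c, hcR, hc⟩ := hF.exists_center
    refine ⟨e.symm c, by simpa using hcR, fun s y hy => ?_⟩
    rw [← e.dist_eq, e.apply_symm_apply]
    exact hc s (e y) hy

theorem isClosed_setOf [ProperSpace X] (ρ : ℝ → ℝ) (R : ℝ) :
    IsClosed {F : X → ℝ | IsCoarseDist ρ R F} := by
  refine isClosed_iff_ultrafilter.2 fun F₀ u hu hmem => ?_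
  replace hmem : ∀ᶠ F in (u : Filter (X → ℝ)), IsCoarseDist ρ R F := hmem
  have h_lim : ∀ x, Tendsto (fun F : X → ℝ => F x) u (𝓝 (F₀ x)) := fun x =>
    ((continuous_apply x).tendsto F₀).mono_left hu
  obtain ⟨c, hc⟩ := (hmem.mono fun F hF => hF.exists_center).choice
  have h_dist : ∀ s x, F₀ x < s → ∀ᶠ F in (u : Filter (X → ℝ)), dist x (c F) ≤ ρ s := by
    intro s x hx
    filter_upwards [hc, (h_lim x).eventually (eventually_lt_nhds hx)] with F hcF hFx
    exact hcF.2 s x hFx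
  obtain ⟨c₀, h_cc₀⟩ : ∃ c₀, Tendsto c u (𝓝 c₀) := by
    obtain ⟨x⟩ : Nonempty X := let ⟨F, hF⟩ := hmem.exists; ⟨hF.exists_center.choose⟩
    have h_ball : ∀ᶠ F in (u : Filter (X → ℝ)), c F ∈ Metric.closedBall x (ρ (F₀ x + 1)) :=
      (h_dist _ x (lt_add_one _)).mono fun F hF => Metric.mem_closedBall'.2 hF
    obtain ⟨c₀, -, h_cc₀⟩ := (isCompact_closedBall _ _).ultrafilter_le_nhds (u.map c)
      (le_principal_iff.2 h_ball)
    exact ⟨c₀, h_cc₀⟩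
  refine ⟨fun x => ge_of_tendsto (h_lim x) (hmem.mono fun F hF => hF.nonneg x), ?_,
    c₀, ?_, fun s x hx => le_of_tendsto (tendsto_const_nhds.dist h_cc₀) (h_dist s x hx)⟩
  · exact (isClosed_setOfPred_lipschitzWith 1).mem_of_tendsto hu
      (hmem.mono fun F hF => hF.lipschitz)
  · have h_bound : Tendsto (fun F => R + dist c₀ (c F)) u (𝓝 R) := by
      simpa using tendsto_const_nhds.add ((tendsto_const_nhds (x := c₀)).dist h_cc₀)
    refine le_of_tendsto_of_tendsto (h_lim c₀) h_bound ?_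
    filter_upwards [hmem, hc] with F hF hcF
    have := hF.lipschitz.dist_le_mul c₀ (c F)
    rw [Real.dist_eq, NNReal.coe_one, one_mul] at this
    linarith [le_abs_self (F c₀ - F (c F)), hcF.1]

end IsCoarseDist

end CoarseDistance

section CoarseGraph

/-- A function on `X × Y` that looks, up to the control function `ρ` and the constant `R`, like the
distance to the graph of a coarse equivalence. -/
structure IsCoarseGraph {X Y : Type*} [PseudoMetricSpace X] [PseudoMetricSpace Y] (ρ : ℝ → ℝ)
    (R : ℝ) (f : X → Y → ℝ) : Prop where
  left : ∀ y, IsCoarseDist ρ R fun x => f x y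
  right : ∀ x, IsCoarseDist ρ R (f x)

namespace IsCoarseGraph

variable {X Y : Type*} [PseudoMetricSpace X] [PseudoMetricSpace Y] {ρ : ℝ → ℝ} {R : ℝ}
  {f : X → Y → ℝ}

theorem comp_isometryEquiv {X' Y' : Type*} [PseudoMetricSpace X'] [PseudoMetricSpace Y']
    (hf : IsCoarseGraph ρ R f) (e : X' ≃ᵢ X) (e' : Y' ≃ᵢ Y) :
    IsCoarseGraph ρ R fun x y => f (e x) (e' y) where
  left y := (hf.left (e' y)).comp_isometryEquiv e
  right x := (hf.right (e x)).comp_isometryEquiv e'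

theorem isClosed_setOf [ProperSpace X] [ProperSpace Y] (ρ : ℝ → ℝ) (R : ℝ) :
    IsClosed {f : X → Y → ℝ | IsCoarseGraph ρ R f} := by
  have h_left : IsClosed {f : X → Y → ℝ | ∀ y, IsCoarseDist ρ R fun x => f x y} := by
    rw [Set.ofPred_forall]
    exact isClosed_iInter fun y => (IsCoarseDist.isClosed_setOf ρ R).preimage
      (f := fun (f : X → Y → ℝ) x => f x y) (by fun_prop)
  have h_right : IsClosed {f : X → Y → ℝ | ∀ x, IsCoarseDist ρ R (f x)} := by
    rw [Set.ofPred_forall]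
    exact isClosed_iInter fun x =>
      (IsCoarseDist.isClosed_setOf ρ R).preimage (continuous_apply x)
  convert h_left.inter h_right using 1
  exact Set.ext fun f => ⟨fun hf => ⟨hf.left, hf.right⟩, fun hf => ⟨hf.1, hf.2⟩⟩

theorem lipschitzWith_uncurry (hf : IsCoarseGraph ρ R f) :
    LipschitzWith (1 + 1) (Function.uncurry f) :=
  LipschitzWith.uncurry (fun y => (hf.left y).lipschitz) fun x => (hf.right x).lipschitz

theorem le_add_dist_add_dist (hf : IsCoarseGraph ρ R f) (x x' : X) (y y' : Y) :
    f x y ≤ f x' y' + dist x x' + dist y y' := by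
  have h_left := (hf.left y).lipschitz.le_add_mul x x'
  have h_right := (hf.right x').lipschitz.le_add_mul y y'
  rw [NNReal.coe_one, one_mul] at h_left h_right
  linarith

end IsCoarseGraph

theorem IsCoarseEquivalence.exists_isCoarseGraph {X Y : Type*} [Nonempty X] [mX : MetricSpace X]
    [mY : MetricSpace Y] {φ : X → Y} (hφ : IsCoarseEquivalence mX mY φ) :
    ∃ ρ R, ∃ f : X → Y → ℝ, IsCoarseGraph ρ R f := by
  obtain ⟨⟨R, hR⟩, h_map, h_back⟩ := isCoarseEquivalence_iff.1 hφ
  choose a ha using h_map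
  choose b hb using h_back
  let Γ : Set (X × Y) := Set.range fun z => (z, φ z)
  have hΓ : Γ.Nonempty := Set.range_nonempty _
  have h_lt : ∀ {x y s}, Metric.infDist (x, y) Γ < s → ∃ z, dist x z < s ∧ dist y (φ z) < s := by
    intro x y s h
    obtain ⟨_, ⟨z, rfl⟩, hz⟩ := (Metric.infDist_lt_iff hΓ).1 h
    exact ⟨z, max_lt_iff.1 hz⟩
  have h_le : ∀ x y z, Metric.infDist (x, y) Γ ≤ max (dist x z) (dist y (φ z)) := fun x y z =>
    Metric.infDist_le_dist_of_mem (Set.mem_range_self z)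
  have h_lipschitz := Metric.lipschitz_infDist_pt Γ
  refine ⟨fun s => s + max (a s) (b (s + R)), R, fun x y => Metric.infDist (x, y) Γ,
    fun y => ⟨fun _ => Metric.infDist_nonneg, ?_, ?_⟩,
    fun x => ⟨fun _ => Metric.infDist_nonneg, ?_, φ x, ?_, fun s y h => ?_⟩⟩
  · exact (h_lipschitz.comp (LipschitzWith.prodMk_right y)).weaken (one_mul 1).le
  · obtain ⟨x₀, hx₀⟩ := hR y
    refine ⟨x₀, (h_le x₀ y x₀).trans (by simpa using hx₀), fun s x h => ?_⟩
    obtain ⟨z, hxz, hyz⟩ := h_lt h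
    have hzx₀ : dist z x₀ ≤ b (s + R) :=
      hb _ _ _ ((dist_triangle_left _ _ y).trans (add_le_add hyz.le hx₀))
    calc dist x x₀ ≤ dist x z + dist z x₀ := dist_triangle _ _ _
      _ ≤ s + max (a s) (b (s + R)) := add_le_add hxz.le (hzx₀.trans (le_max_right _ _))
  · exact (h_lipschitz.comp (LipschitzWith.prodMk_left x)).weaken (one_mul 1).le
  · obtain ⟨x₀, hx₀⟩ := hR (φ x)
    exact (h_le x (φ x) x).trans (by simpa using dist_nonneg.trans hx₀)
  · obtain ⟨z, hxz, hyz⟩ := h_lt h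
    have hzx : dist (φ z) (φ x) ≤ a s := ha _ _ _ (dist_comm x z ▸ hxz.le)
    calc dist y (φ x) ≤ dist y (φ z) + dist (φ z) (φ x) := dist_triangle _ _ _
      _ ≤ s + max (a s) (b (s + R)) := add_le_add hyz.le (hzx.trans (le_max_left _ _))

theorem isClosed_setOf_image_inter_nonempty {T X Y : Type*} [TopologicalSpace T]
    [TopologicalSpace X] [TopologicalSpace Y] {a : T → X → Y}
    (ha : Continuous fun p : T × X => a p.1 p.2) {K : Set X} (hK : IsCompact K) {L : Set Y}
    (hL : IsClosed L) : IsClosed {t | (a t '' K ∩ L).Nonempty} := by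
  have : CompactSpace K := isCompact_iff_compactSpace.1 hK
  have h_closed : IsClosed {p : T × K | a p.1 p.2 ∈ L} :=
    hL.preimage (ha.comp (continuous_id.prodMap continuous_subtype_val))
  convert isClosedMap_fst_of_compactSpace _ h_closed
  ext t
  simp [Set.Nonempty]

/-- The space of coarse graphs with fixed control data, with the topology of pointwise convergence.
Translating the two variables turns it into a topological coupling. -/
def CoarseGraph (X Y : Type*) [PseudoMetricSpace X] [PseudoMetricSpace Y] (ρ : ℝ → ℝ) (R : ℝ) :
    Type _ :=
  {f : X → Y → ℝ // IsCoarseGraph ρ R f}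

namespace CoarseGraph

section Topology

variable {X Y : Type*} [PseudoMetricSpace X] [PseudoMetricSpace Y] {ρ : ℝ → ℝ} {R : ℝ}

instance : TopologicalSpace (CoarseGraph X Y ρ R) :=
  inferInstanceAs (TopologicalSpace {f : X → Y → ℝ // IsCoarseGraph ρ R f})

instance : T2Space (CoarseGraph X Y ρ R) :=
  inferInstanceAs (T2Space {f : X → Y → ℝ // IsCoarseGraph ρ R f})

instance : CoeFun (CoarseGraph X Y ρ R) fun _ => X → Y → ℝ := ⟨Subtype.val⟩

@[ext]
theorem ext {f f' : CoarseGraph X Y ρ R} (h : ∀ x y, f x y = f' x y) : f = f' :=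
  Subtype.ext (funext₂ h)

theorem continuous_iff {T : Type*} [TopologicalSpace T] {F : T → CoarseGraph X Y ρ R} :
    Continuous F ↔ ∀ x y, Continuous fun t => F t x y :=
  continuous_induced_rng.trans
    (continuous_pi_iff.trans (forall_congr' fun _ => continuous_pi_iff))

theorem continuous_apply_apply (x : X) (y : Y) :
    Continuous fun f : CoarseGraph X Y ρ R => f x y :=
  continuous_iff.1 continuous_id x y

theorem continuous_eval :
    Continuous fun p : (X × Y) × CoarseGraph X Y ρ R => p.2 p.1.1 p.1.2 :=
  continuous_prod_of_continuous_lipschitzWith _ (1 + 1)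
    (fun q => continuous_apply_apply q.1 q.2) fun f => f.2.lipschitzWith_uncurry

theorem isCompact_setOf_apply_le [ProperSpace X] [ProperSpace Y] (x : X) (y : Y) (r : ℝ) :
    IsCompact {f : CoarseGraph X Y ρ R | f x y ≤ r} := by
  have h_box : IsCompact (Set.univ.pi fun x' => Set.univ.pi fun y' =>
      Set.Icc 0 (r + dist x' x + dist y' y)) :=
    isCompact_univ_pi fun _ => isCompact_univ_pi fun _ => isCompact_Icc
  have h_emb : IsClosedEmbedding (Subtype.val : CoarseGraph X Y ρ R → X → Y → ℝ) :=
    (IsCoarseGraph.isClosed_setOf ρ R).isClosedEmbedding_subtypeVal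
  refine (h_emb.isCompact_preimage h_box).of_isClosed_subset
    (isClosed_le (continuous_apply_apply x y) continuous_const) ?_
  intro f (hf : f.1 x y ≤ r) x' _ y' _
  exact ⟨(f.2.right x').nonneg y', (f.2.le_add_dist_add_dist x' x y' y).trans (by gcongr)⟩

theorem exists_forall_mem_apply_lt {K : Set (CoarseGraph X Y ρ R)} (hK : IsCompact K) (x : X)
    (y : Y) : ∃ s, ∀ f ∈ K, f x y < s := by
  obtain ⟨s, hs⟩ := (hK.image (continuous_apply_apply x y)).bddAbove
  exact ⟨s + 1, fun f hf => (hs ⟨f, hf, rfl⟩).trans_lt (lt_add_one _)⟩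

instance [Nonempty X] [Nonempty Y] [ProperSpace X] [ProperSpace Y] :
    LocallyCompactSpace (CoarseGraph X Y ρ R) := by
  obtain ⟨x⟩ := ‹Nonempty X›
  obtain ⟨y⟩ := ‹Nonempty Y›
  have : WeaklyLocallyCompactSpace (CoarseGraph X Y ρ R) := ⟨fun f =>
    ⟨_, isCompact_setOf_apply_le x y (f x y + 1),
      (continuous_apply_apply x y).continuousAt.eventually (eventually_le_nhds (lt_add_one _))⟩⟩
  infer_instance

end Topology

section LeftAction

variable {G Y : Type*} [Group G] [PseudoMetricSpace G] [IsIsometricSMul G G]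
  [PseudoMetricSpace Y] {ρ : ℝ → ℝ} {R : ℝ}

instance : MulAction G (CoarseGraph G Y ρ R) where
  smul g f := ⟨fun x y => f (g⁻¹ * x) y,
    f.2.comp_isometryEquiv (IsometryEquiv.mulLeft g⁻¹) (IsometryEquiv.refl Y)⟩
  one_smul f := ext fun x y => congrArg (f · y) (by simp)
  mul_smul g g' f := ext fun x y => congrArg (f · y) (by simp [mul_assoc])

theorem smul_apply (g : G) (f : CoarseGraph G Y ρ R) (x : G) (y : Y) :
    (g • f) x y = f (g⁻¹ * x) y := rfl

theorem iUnion_smul_setOf_apply_one_le (y : Y) :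
    ⋃ g : G, g • {f : CoarseGraph G Y ρ R | f 1 y ≤ R} = Set.univ := by
  refine Set.eq_univ_of_forall fun f => ?_
  obtain ⟨x, hx, -⟩ := (f.2.left y).exists_center
  refine Set.mem_iUnion.2 ⟨x, Set.mem_smul_set_iff_inv_smul_mem.2 ?_⟩
  simpa only [Set.mem_ofPred_eq, smul_apply, inv_inv, mul_one] using hx

variable [IsTopologicalGroup G]

theorem continuous_smul : Continuous fun p : G × CoarseGraph G Y ρ R => p.1 • p.2 :=
  continuous_iff.2 fun x y => continuous_eval.comp
    (f := fun p : G × CoarseGraph G Y ρ R => ((p.1⁻¹ * x, y), p.2)) (by fun_prop)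

theorem isCompact_setOf_smul_inter_nonempty [ProperSpace G] [Nonempty Y]
    {K : Set (CoarseGraph G Y ρ R)} (hK : IsCompact K) :
    IsCompact {g : G | (g • K ∩ K).Nonempty} := by
  obtain ⟨y⟩ := ‹Nonempty Y›
  obtain ⟨s, hs⟩ := exists_forall_mem_apply_lt hK 1 y
  refine (isCompact_closedBall (1 : G) (2 * ρ s)).of_isClosed_subset
    (isClosed_setOf_image_inter_nonempty continuous_smul hK hK.isClosed) ?_
  rintro g ⟨_, ⟨f, hf, rfl⟩, hgf⟩
  rw [Metric.mem_closedBall, ← dist_inv_mul_one]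
  exact (f.2.left y).dist_le (hs _ hgf) (hs f hf)

end LeftAction

section RightAction

variable {X H : Type*} [PseudoMetricSpace X] [Group H] [PseudoMetricSpace H]
  [IsIsometricSMul H H] {ρ : ℝ → ℝ} {R : ℝ}

instance : MulAction Hᵐᵒᵖ (CoarseGraph X H ρ R) where
  smul h f := ⟨fun x y => f x (h.unop * y),
    f.2.comp_isometryEquiv (IsometryEquiv.refl X) (IsometryEquiv.mulLeft h.unop)⟩
  one_smul f := ext fun x y => congrArg (f x) (by simp)
  mul_smul h h' f := ext fun x y => congrArg (f x) (by simp [mul_assoc])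

theorem op_smul_apply (h : H) (f : CoarseGraph X H ρ R) (x : X) (y : H) :
    (op h • f) x y = f x (h * y) := rfl

theorem iUnion_op_smul_setOf_apply_one_le (x : X) :
    ⋃ h : H, op h • {f : CoarseGraph X H ρ R | f x 1 ≤ R} = Set.univ := by
  refine Set.eq_univ_of_forall fun f => ?_
  obtain ⟨y, hy, -⟩ := (f.2.right x).exists_center
  refine Set.mem_iUnion.2 ⟨y⁻¹, Set.mem_smul_set_iff_inv_smul_mem.2 ?_⟩
  simpa only [Set.mem_ofPred_eq, ← op_inv, op_smul_apply, inv_inv, mul_one] using hy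

variable [ContinuousMul H]

theorem continuous_op_smul : Continuous fun p : CoarseGraph X H ρ R × H => op p.2 • p.1 :=
  continuous_iff.2 fun x y => continuous_eval.comp
    (f := fun p : CoarseGraph X H ρ R × H => ((x, p.2 * y), p.1)) (by fun_prop)

theorem isCompact_setOf_op_smul_inter_nonempty [Nonempty X] [ProperSpace H]
    {K : Set (CoarseGraph X H ρ R)} (hK : IsCompact K) :
    IsCompact {h : H | (op h • K ∩ K).Nonempty} := by
  obtain ⟨x⟩ := ‹Nonempty X›
  obtain ⟨s, hs⟩ := exists_forall_mem_apply_lt hK x 1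
  refine (isCompact_closedBall (1 : H) (2 * ρ s)).of_isClosed_subset
    (isClosed_setOf_image_inter_nonempty (continuous_op_smul.comp continuous_swap) hK
      hK.isClosed) ?_
  rintro h ⟨_, ⟨f, hf, rfl⟩, hhf⟩
  rw [Metric.mem_closedBall, ← mul_one h]
  exact (f.2.right x).dist_le (hs _ hhf) (hs f hf)

end RightAction

theorem isTopologicalCoupling {G H : Type*} [Group G] [PseudoMetricSpace G]
    [IsIsometricSMul G G] [ProperSpace G] [IsTopologicalGroup G] [Group H] [PseudoMetricSpace H]
    [IsIsometricSMul H H] [ProperSpace H] [ContinuousMul H] {ρ : ℝ → ℝ} {R : ℝ}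
    (f : CoarseGraph G H ρ R) : IsTopologicalCoupling G H (CoarseGraph G H ρ R) where
  nonempty := ⟨f⟩
  t2Space := inferInstance
  locallyCompactSpace := inferInstance
  commute _ _ _ := rfl
  continuous_left := continuous_smul
  continuous_right := continuous_op_smul
  proper_left _ := isCompact_setOf_smul_inter_nonempty
  proper_right _ := isCompact_setOf_op_smul_inter_nonempty
  cocompact := ⟨{f | f 1 1 ≤ R}, isCompact_setOf_apply_le 1 1 R,
    iUnion_smul_setOf_apply_one_le 1, iUnion_op_smul_setOf_apply_one_le 1⟩

end CoarseGraph

end CoarseGraph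

section Transport

theorem smul_image_inter_image_nonempty_iff {M X Y : Type*} [SMul M X] [SMul M Y] {e : X → Y}
    (h_inj : Function.Injective e) {m : M} (he : ∀ x, e (m • x) = m • e x) (K : Set X) :
    (m • e '' K ∩ e '' K).Nonempty ↔ (m • K ∩ K).Nonempty := by
  rw [← Set.image_smul_comm e m K he, ← Set.image_inter h_inj, Set.image_nonempty]

theorem iUnion_smul_image_eq_univ {ι M X Y : Type*} [SMul M X] [SMul M Y] {e : X → Y}
    (h_surj : Function.Surjective e) {m : ι → M} (he : ∀ i x, e (m i • x) = m i • e x)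
    {K : Set X} (hK : ⋃ i, m i • K = Set.univ) : ⋃ i, m i • e '' K = Set.univ := by
  simp only [← Set.image_smul_comm e _ K (he _), ← Set.image_iUnion, hK,
    Set.image_univ_of_surjective h_surj]

theorem IsTopologicalCoupling.of_homeomorph {G H X Y : Type*} [Group G] [TopologicalSpace G]
    [Group H] [TopologicalSpace H] [TopologicalSpace X] [MulAction G X] [MulAction Hᵐᵒᵖ X]
    [TopologicalSpace Y] [MulAction G Y] [MulAction Hᵐᵒᵖ Y] (hX : IsTopologicalCoupling G H X)
    (e : X ≃ₜ Y) (he_left : ∀ (g : G) x, e (g • x) = g • e x)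
    (he_right : ∀ (h : H) x, e (op h • x) = op h • e x) : IsTopologicalCoupling G H Y := by
  have h_left : ∀ (g : G) y, g • y = e (g • e.symm y) := fun g y => by
    rw [he_left, e.apply_symm_apply]
  have h_right : ∀ (h : H) y, op h • y = e (op h • e.symm y) := fun h y => by
    rw [he_right, e.apply_symm_apply]
  have h_image : ∀ K : Set Y, e '' (e.symm '' K) = K := e.toEquiv.image_symm_image
  obtain ⟨K, hK, hGK, hHK⟩ := hX.cocompact
  have := hX.t2Space
  have := hX.locallyCompactSpace
  refine ⟨hX.nonempty.map e, e.t2Space, e.symm.isClosedEmbedding.locallyCompactSpace,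
    fun g h y => ?_, ?_, ?_, fun L hL => ?_, fun L hL => ?_,
    e '' K, hK.image e.continuous, iUnion_smul_image_eq_univ e.surjective he_left hGK,
    iUnion_smul_image_eq_univ e.surjective he_right hHK⟩
  · simp only [h_left, h_right, e.symm_apply_apply, hX.commute]
  · simp only [h_left]
    exact e.continuous.comp (hX.continuous_left.comp (continuous_id.prodMap e.symm.continuous))
  · simp only [h_right]
    exact e.continuous.comp (hX.continuous_right.comp (e.symm.continuous.prodMap continuous_id))
  · simpa only [← smul_image_inter_image_nonempty_iff e.injective (he_left _), h_image]
      using hX.proper_left _ (hL.image e.symm.continuous)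
  · simpa only [← smul_image_inter_image_nonempty_iff e.injective (he_right _), h_image]
      using hX.proper_right _ (hL.image e.symm.continuous)

end Transport

namespace IsCompatibleProperLeftInvariant

variable {G : Type*} [Group G] [m : MetricSpace G]

theorem isIsometricSMul (hm : IsCompatibleProperLeftInvariant m) : IsIsometricSMul G G :=
  ⟨fun g => Isometry.of_dist_eq (hm.left_invariant g)⟩

theorem properSpace (hm : IsCompatibleProperLeftInvariant m) : ProperSpace G :=
  ⟨hm.proper⟩

end IsCompatibleProperLeftInvariant

theorem exists_isCoarseEquivalence_iff_admitTopologicalCoupling (G : Type u) (H : Type v)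
    [Group G] [TopologicalSpace G] [IsTopologicalGroup G]
    [Group H] [TopologicalSpace H] [ContinuousMul H]
    {dG : MetricSpace G} {dH : MetricSpace H}
    (hG : IsCompatibleProperLeftInvariant dG) (hH : IsCompatibleProperLeftInvariant dH) :
    (∃ φ : G → H, IsCoarseEquivalence dG dH φ) ↔ AdmitTopologicalCoupling.{u, v, w} G H := by
  obtain rfl := hG.compatible
  obtain rfl := hH.compatible
  have := hG.isIsometricSMul
  have := hH.isIsometricSMul
  have := hG.properSpace
  have := hH.properSpace
  constructor
  · rintro ⟨φ, hφ⟩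
    obtain ⟨ρ, R, f, hf⟩ := hφ.exists_isCoarseGraph
    have hX : IsTopologicalCoupling G H (CoarseGraph G H ρ R) :=
      CoarseGraph.isTopologicalCoupling ⟨f, hf⟩
    exact ⟨ULift.{w} (CoarseGraph G H ρ R), _, _, _,
      hX.of_homeomorph Homeomorph.ulift.symm (fun _ _ => rfl) fun _ _ => rfl⟩
  · rintro ⟨X, _, _, _, hX⟩
    exact hX.exists_isCoarseEquivalence

theorem theorem1 (G : Type u) (H : Type v)
    [Group G] [TopologicalSpace G] [IsTopologicalGroup G] [T2Space G]
    [LocallyCompactSpace G] [SecondCountableTopology G]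
    [Group H] [TopologicalSpace H] [IsTopologicalGroup H] [T2Space H]
    [LocallyCompactSpace H] [SecondCountableTopology H] :
    (CoarselyEquivalent G H ↔ AdmitTopologicalCoupling.{u, v, w} G H) ∧
      ∀ (dG : MetricSpace G) (dH : MetricSpace H),
        IsCompatibleProperLeftInvariant dG → IsCompatibleProperLeftInvariant dH →
          ((∃ φ : G → H, IsCoarseEquivalence dG dH φ) ↔
            AdmitTopologicalCoupling.{u, v, w} G H) := by
  refine ⟨⟨?_, fun h => ?_⟩, fun dG dH hG hH =>
    exists_isCoarseEquivalence_iff_admitTopologicalCoupling G H hG hH⟩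
  · rintro ⟨dG, dH, hG, hH, h⟩
    exact (exists_isCoarseEquivalence_iff_admitTopologicalCoupling G H hG hH).1 h
  · obtain ⟨dG, hG⟩ := exists_isCompatibleProperLeftInvariant G
    obtain ⟨dH, hH⟩ := exists_isCompatibleProperLeftInvariant H
    exact ⟨dG, dH, hG, hH,
      (exists_isCoarseEquivalence_iff_admitTopologicalCoupling G H hG hH).2 h⟩
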